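/- Let $\mathbb{K}$ be an algebraically closed field of characteristic zero. For a Lie algebra $\mathfrak g$ put $\mathfrak g^0=\mathfrak g$ and $\mathfrak g^{i+1}=[\mathfrak g,\mathfrak g^i]$. For a finite simple graph $G=(V,E)$ and $k\ge 1$, let $L$ be the free Lie algebra over $\mathbb{K}$ on the set $V$, let $L_{(k)}=L/L^{k}$ be the free $k$-step nilpotent Lie algebra on $V$, and let $$\mathfrak g(k,G)=L_{(k)}/I,$$ where $I$ is the ideal of $L_{(k)}$ generated by the brackets $[v,w]$ of distinct vertices $v,w\in V$ with $\{v,w\}\notin E$. This is a finite-dimensional Lie algebra with $\mathfrak g(k,G)^k=0$, called the $k$-step graph Lie algebra of $G$. Let $\mathcal N_{n,k}$ be the variety of all Lie brackets $\mu$ on $\mathbb{K}^n$ that are at most $k$-step nilpotent (that is, $(\mathbb{K}^n,\mu)^k=0$), with the Zariski topology induced from the affine space of bilinear maps $\mathbb{K}^n\times\mathbb{K}^n\to\mathbb{K}^n$, and let $GL(n,\mathbb{K})$ act on it by $(g\cdot\mu)(x,y)=g\,\mu(g^{-1}x,g^{-1}y)$. A Lie algebra $\mathfrak g$ of dimension $n$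 with $\mathfrak g^k=0$ is called $k$-rigid if the $GL(n,\mathbb{K})$-orbit of the bracket it induces on $\mathbb{K}^n$ (through any basis of $\mathfrak g$) is open in $\mathcal N_{n,k}$. **Theorem.** Let $G=(V,E)$ be a finite simple graph with $|V|\ge 3$ which is not a complete graph, and let $k\ge 3$. Then $\mathfrak g(k,G)$ is not $k$-rigid. -/

import Mathlib

/-! ### The `k`-step graph Lie algebra -/

/-- The free `k`-step nilpotent Lie algebra on `V`: the free Lie algebra modulo the `k`-th term of
its descending central series `𝔤⁰ = 𝔤`, `𝔤ⁱ⁺¹ = [𝔤, 𝔤ⁱ]`. -/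
abbrev FreeNilpotentLieAlgebra (K : Type*) [Field K] (k : ℕ) (V : Type*) :=
  FreeLieAlgebra K V ⧸
    LieModule.lowerCentralSeries K (FreeLieAlgebra K V) (FreeLieAlgebra K V) k

namespace FreeNilpotentLieAlgebra

/-- The generator of the free `k`-step nilpotent Lie algebra given by `v ∈ V`. -/
noncomputable def of (K : Type*) [Field K] (k : ℕ) {V : Type*} (v : V) : FreeNilpotentLieAlgebra K k V :=
  LieSubmodule.Quotient.mk (FreeLieAlgebra.of K v)

end FreeNilpotentLieAlgebra

/-- The ideal of the free `k`-step nilpotent Lie algebra on the vertices of `G` generated by the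
brackets of the pairs of distinct vertices that are not joined by an edge. -/
noncomputable def nonEdgeIdeal (K : Type*) [Field K] (k : ℕ) {V : Type*} (G : SimpleGraph V) :
    LieIdeal K (FreeNilpotentLieAlgebra K k V) :=
  LieSubmodule.lieSpan K (FreeNilpotentLieAlgebra K k V)
    {x | ∃ v w : V, v ≠ w ∧ ¬ G.Adj v w ∧
      x = ⁅FreeNilpotentLieAlgebra.of K k v, FreeNilpotentLieAlgebra.of K k w⁆}

/-- The `k`-step graph Lie algebra `𝔤(k, G)`. -/
abbrev GraphLieAlgebra (K : Type*) [Field K] (k : ℕ) {V : Type*} (G : SimpleGraph V) :=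
  FreeNilpotentLieAlgebra K k V ⧸ nonEdgeIdeal K k G

/-! ### `𝔤(k, G)` is at most `k`-step nilpotent and finite dimensional -/

namespace GraphLieAlgebra

/-- The projection of a Lie algebra onto its quotient by an ideal. -/
def proj {K L : Type*} [Field K] [LieRing L] [LieAlgebra K L] (I : LieIdeal K L) :
    L →ₗ⁅K⁆ L ⧸ I :=
  { (LieSubmodule.Quotient.mk' I : L →ₗ[K] L ⧸ I) with
    map_lie' := fun {x y} => LieSubmodule.Quotient.mk_bracket I x y }

theorem proj_surjective {K L : Type*} [Field K] [LieRing L] [LieAlgebra K L] (I : LieIdeal K L) :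
    Function.Surjective (proj I) :=
  LieSubmodule.Quotient.surjective_mk' I

theorem lowerCentralSeries_quotient_eq_bot {K L : Type*} [Field K] [LieRing L] [LieAlgebra K L]
    (I : LieIdeal K L) (k : ℕ) (h : LieModule.lowerCentralSeries K L L k ≤ I) :
    LieModule.lowerCentralSeries K (L ⧸ I) (L ⧸ I) k = ⊥ := by
  rw [← LieIdeal.lowerCentralSeries_map_eq k (proj_surjective I), eq_bot_iff,
    LieIdeal.map_le_iff_le_comap]
  intro x hx
  rw [LieIdeal.mem_comap, LieSubmodule.mem_bot]
  exact (LieSubmodule.Quotient.mk_eq_zero I).2 (h hx)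

/-- `𝔤(k, G)` is at most `k`-step nilpotent. -/
theorem lowerCentralSeries_eq_bot (K : Type*) [Field K] (k : ℕ) {V : Type*} (G : SimpleGraph V) :
    LieModule.lowerCentralSeries K (GraphLieAlgebra K k G) (GraphLieAlgebra K k G) k = ⊥ := by
  refine lowerCentralSeries_quotient_eq_bot _ k ?_
  rw [lowerCentralSeries_quotient_eq_bot _ k le_rfl]
  exact bot_le

theorem subalgebra_eq_top {K V : Type*} [Field K] (A : LieSubalgebra K (FreeLieAlgebra K V))
    (h : ∀ v, FreeLieAlgebra.of K v ∈ A) : A = ⊤ := by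
  have key : A.incl.comp (FreeLieAlgebra.lift K fun v => (⟨FreeLieAlgebra.of K v, h v⟩ : A)) =
      LieHom.id := by
    ext v; simp
  refine eq_top_iff.2 fun x _ => ?_
  have := congrArg (fun f => f x) key
  simp only [LieHom.comp_apply, LieHom.id_apply] at this
  rw [← this]
  exact Subtype.prop _

theorem finite_of_surjective {K V L : Type*} [Field K] [Finite V] [LieRing L] [LieAlgebra K L]
    (f : FreeLieAlgebra K V →ₗ⁅K⁆ L) (hf : Function.Surjective f) (k : ℕ)
    (hk : LieModule.lowerCentralSeries K L L k = ⊥) : Module.Finite K L := by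
  have gen : ∀ A : LieSubalgebra K L, (∀ v, f (FreeLieAlgebra.of K v) ∈ A) → ∀ x, x ∈ A := by
    intro A hA x
    obtain ⟨y, rfl⟩ := hf x
    have := subalgebra_eq_top (A.comap f) hA
    have hy : y ∈ A.comap f := by rw [this]; trivial
    exact hy
  let W : Submodule K L := Submodule.span K (Set.range fun v => f (FreeLieAlgebra.of K v))
  let br : L →ₗ[K] L →ₗ[K] L := (LieModule.toEnd K L L : L →ₗ[K] Module.End K L)
  let P : ℕ → Submodule K L := fun i => Nat.rec W (fun _ p => Submodule.map₂ br W p) i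
  have hPs : ∀ i, P (i + 1) = Submodule.map₂ br W (P i) := fun i => rfl
  have hPl : ∀ i, P i ≤ (LieModule.lowerCentralSeries K L L i).toSubmodule := by
    intro i
    induction i with
    | zero => simp
    | succ i ih =>
      rw [hPs, Submodule.map₂_le]
      intro x _ y hy
      rw [LieModule.lowerCentralSeries_succ]
      exact LieSubmodule.lie_mem_lie (LieSubmodule.mem_top x) (ih hy)
  have hPf : ∀ i, (P i).FG := by
    intro i
    induction i with
    | zero => exact Submodule.fg_span (Set.finite_range _)
    | succ i ih => exact Submodule.FG.map₂ _ (Submodule.fg_span (Set.finite_range _)) ih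
  let Q : Submodule K L := ⨆ i : Fin (k + 1), P i
  have hQ : ∀ v, ∀ x ∈ Q, ⁅f (FreeLieAlgebra.of K v), x⁆ ∈ Q := by
    intro v
    suffices Q ≤ Q.comap (br (f (FreeLieAlgebra.of K v))) from fun x hx => this hx
    refine iSup_le fun i x hx => ?_
    have hm : ⁅f (FreeLieAlgebra.of K v), x⁆ ∈ P (i + 1) :=
      Submodule.apply_mem_map₂ br (Submodule.subset_span ⟨v, rfl⟩) hx
    by_cases hi : (i : ℕ) + 1 < k + 1
    · exact (le_iSup (fun i : Fin (k + 1) => P i) ⟨i + 1, hi⟩) hm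
    · have hik : (i : ℕ) = k := by omega
      have : x ∈ (LieModule.lowerCentralSeries K L L k).toSubmodule := hPl k (hik ▸ hx)
      rw [hk] at this
      have hx0 : x = 0 := by simpa using this
      subst hx0
      simp
  let N : LieSubalgebra K L :=
    { carrier := {x | ∀ y ∈ Q, ⁅x, y⁆ ∈ Q}
      add_mem' := fun ha hb y hy => by rw [add_lie]; exact Q.add_mem (ha y hy) (hb y hy)
      zero_mem' := fun y _ => by simp
      smul_mem' := fun c a ha y hy => by rw [smul_lie]; exact Q.smul_mem c (ha y hy)
      lie_mem' := fun {a b} ha hb y hy => by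
        rw [lie_lie]; exact Q.sub_mem (ha _ (hb y hy)) (hb _ (ha y hy)) }
  have hN : ∀ x, ∀ y ∈ Q, ⁅x, y⁆ ∈ Q := gen N hQ
  have hT : ∀ x, x ∈ Q :=
    gen { Q with lie_mem' := fun {a b} _ hb => hN a b hb }
      fun v => (le_iSup (fun i : Fin (k + 1) => P i) 0) (Submodule.subset_span ⟨v, rfl⟩)
  have hQT : Q = ⊤ := eq_top_iff.2 fun x _ => hT x
  refine ⟨hQT ▸ Submodule.fg_iSup _ fun i => hPf i⟩

instance finite (K : Type*) [Field K] (k : ℕ) {V : Type*} [Finite V] (G : SimpleGraph V) :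
    Module.Finite K (GraphLieAlgebra K k G) := by
  exact finite_of_surjective ((proj (nonEdgeIdeal K k G)).comp (proj _))
    ((proj_surjective _).comp (proj_surjective _)) k (lowerCentralSeries_eq_bot K k G)

end GraphLieAlgebra

/-! ### The variety of at most `k`-step nilpotent Lie brackets on `Kⁿ` and rigidity -/

/-- Bilinear maps `Kⁿ × Kⁿ → Kⁿ`. -/
abbrev BilinearBracket (K : Type*) [Field K] (n : ℕ) :=
  (Fin n → K) →ₗ[K] (Fin n → K) →ₗ[K] (Fin n → K)

namespace BilinearBracket

variable {K : Type*} [Field K] {n : ℕ}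

/-- `μ` is a Lie bracket: alternating, with the Jacobi identity. -/
def IsLieBracket (μ : BilinearBracket K n) : Prop :=
  (∀ x, μ x x = 0) ∧
    ∀ x y z, μ x (μ y z) + μ y (μ z x) + μ z (μ x y) = 0

/-- The descending central series of `μ`: `𝔤⁰ = Kⁿ`, `𝔤ⁱ⁺¹ = μ(Kⁿ, 𝔤ⁱ)`. -/
def centralSeries (μ : BilinearBracket K n) : ℕ → Submodule K (Fin n → K)
  | 0 => ⊤
  | i + 1 => Submodule.map₂ μ ⊤ (centralSeries μ i)

variable (K n) in
/-- The variety `𝒩_{n,k}` of Lie brackets on `Kⁿ` that are at most `k`-step nilpotent. -/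
def nilpotentVariety (k : ℕ) : Set (BilinearBracket K n) :=
  {μ | μ.IsLieBracket ∧ μ.centralSeries k = ⊥}

/-- The action of `GL(n, K)` on brackets, `(g • μ)(x, y) = g μ(g⁻¹ x, g⁻¹ y)`. -/
def act (g : (Fin n → K) ≃ₗ[K] (Fin n → K)) (μ : BilinearBracket K n) : BilinearBracket K n :=
  (μ.compl₁₂ g.symm.toLinearMap g.symm.toLinearMap).compr₂ g.toLinearMap

/-- The orbit of `μ` under `GL(n, K)`, that is, its isomorphism class. -/
def orbit (μ : BilinearBracket K n) : Set (BilinearBracket K n) :=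
  Set.range fun g : (Fin n → K) ≃ₗ[K] (Fin n → K) => act g μ

/-- The structure constants of `μ` in the standard basis of `Kⁿ`, i.e. the coordinates of `μ` in
the affine space of bilinear maps: `μ(e_i, e_j) = ∑ l, c (i, j, l) e_l`. -/
def structureConstants (μ : BilinearBracket K n) : Fin n × Fin n × Fin n → K :=
  fun p => μ (Pi.single p.1 1) (Pi.single p.2.1 1) p.2.2

/-- `U` is a Zariski open subset of `X` (for the topology induced on `X` by the Zariski topology of
the affine space of bilinear maps): it is the complement in `X` of the common zero set of some
polynomials in the structure constants. -/
def IsZariskiOpenIn (X U : Set (BilinearBracket K n)) : Prop :=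
  ∃ S : Set (MvPolynomial (Fin n × Fin n × Fin n) K),
    U = {μ ∈ X | ¬ ∀ p ∈ S, MvPolynomial.eval μ.structureConstants p = 0}

/-- `μ ∈ 𝒩_{n,k}` is `k`-rigid: its orbit is Zariski open in `𝒩_{n,k}`. -/
def IsRigid (k : ℕ) (μ : BilinearBracket K n) : Prop :=
  μ ∈ nilpotentVariety K n k ∧ IsZariskiOpenIn (nilpotentVariety K n k) μ.orbit

/-- The bracket of a Lie algebra of dimension `n`, transported to `Kⁿ` by a basis. -/
noncomputable def ofBasis {L : Type*} [LieRing L] [LieAlgebra K L]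
    (b : Module.Basis (Fin n) K L) : BilinearBracket K n :=
  LinearMap.mk₂ K (fun x y => b.equivFun ⁅b.equivFun.symm x, b.equivFun.symm y⁆)
    (by intros; simp only [map_add, add_lie]) (by intros; simp only [map_smul, smul_lie])
    (by intros; simp only [map_add, lie_add]) (by intros; simp only [map_smul, lie_smul])

end BilinearBracket

/-- A finite-dimensional Lie algebra is `k`-rigid if the bracket that it induces on `Kⁿ`, where `n`
is its dimension, through some basis is `k`-rigid. Another basis gives a bracket in the same
`GL(n, K)`-orbit, so the choice of the basis is immaterial. -/
def IsKRigid (K : Type*) [Field K] (k : ℕ) (L : Type*) [LieRing L] [LieAlgebra K L]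
    [Module.Finite K L] : Prop :=
  ∃ b : Module.Basis (Fin (Module.finrank K L)) K L, (BilinearBracket.ofBasis b).IsRigid k

/-!
If `𝔤` is `k`-rigid, then on every line `⁅x, y⁆ + t φ(x, y)` of at most `k`-step nilpotent Lie
brackets some point with `t ≠ 0` is isomorphic to `𝔤`, because a nonzero polynomial in `t` over an
infinite field has a nonzero value away from `0`. The lines used here are spanned by
`φ = (α ∧ β) ⊗ z` for characters `α`, `β` of `𝔤 = 𝔤(k, G)` and a central element `z`.

Suppose that `u v` is an edge and `v w` is not, and take `φ = (v* ∧ w*) ⊗ ad(u)^(k-1) v`, so that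
`⁅v, w⁆` is deformed from `0` to `t z`, where `z = ad(u)^(k-1) v`. In `𝔤(k, G)`, if `⁅x, y⁆` lies in
`𝔤² = ⁅𝔤, ⁅𝔤, 𝔤⁆⁆`, then the minors `u*(x) v*(y) - v*(x) u*(y)` vanish for all edges `u v`, so that
the linear parts of `x` and `y` commute: a pair that commutes modulo `𝔤²` is congruent modulo
`⁅𝔤, 𝔤⁆` to a commuting pair. An isomorphism transports this property to the deformation, whose `𝔤²`
is the same and contains `t z`, and gives `a ≡ v` and `b ≡ w` modulo `⁅𝔤, 𝔤⁆` with
`⁅a, b⁆ + t z = 0`. The filiform Lie algebra of class `k`, to which `𝔤(k, G)` maps by killing all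
the vertices other than `u` and `v`, excludes this: `a` and `b` have no component along `u`, so
`⁅a, b⁆` is mapped to zero, while `z` is not.

If `G` is neither complete nor edgeless, such `u`, `v`, `w` exist. If `G` is edgeless, then
`𝔤(k, G)` is abelian, and it has a nonabelian central deformation.
-/

/-! ### The lower central series -/

section LowerCentralSeries

open LieModule

variable {R L M : Type*} [CommRing R] [LieRing L] [LieAlgebra R L] [AddCommGroup M] [Module R M]
  [LieRingModule L M]

theorem lie_mem_lowerCentralSeries_succ {i : ℕ} (x : L) {m : M}
    (hm : m ∈ lowerCentralSeries R L M i) : ⁅x, m⁆ ∈ lowerCentralSeries R L M (i + 1) := by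
  rw [lowerCentralSeries_succ]
  exact LieSubmodule.lie_mem_lie (LieSubmodule.mem_top x) hm

theorem lowerCentralSeries_eq_bot_of_le {i j : ℕ} (hij : i ≤ j)
    (h : lowerCentralSeries R L M i = ⊥) : lowerCentralSeries R L M j = ⊥ :=
  eq_bot_mono (antitone_lowerCentralSeries R L M hij) h

variable [LieModule R L M]

theorem lowerCentralSeries_succ_le_iff {i : ℕ} {N : Submodule R M} :
    (lowerCentralSeries R L M (i + 1)).toSubmodule ≤ N ↔
      ∀ x : L, ∀ m ∈ lowerCentralSeries R L M i, ⁅x, m⁆ ∈ N := by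
  refine ⟨fun h x m hm => h (lie_mem_lowerCentralSeries_succ x hm), fun h => ?_⟩
  rw [lowerCentralSeries_succ, LieSubmodule.lieIdeal_oper_eq_linear_span', Submodule.span_le]
  rintro _ ⟨x, -, m, hm, rfl⟩
  exact h x m hm

theorem lowerCentralSeries_one_le_iff {N : Submodule R M} :
    (lowerCentralSeries R L M 1).toSubmodule ≤ N ↔ ∀ (x : L) (m : M), ⁅x, m⁆ ∈ N :=
  (lowerCentralSeries_succ_le_iff (i := 0)).trans (by simp)

theorem lowerCentralSeries_two_le_iff {N : Submodule R M} :
    (lowerCentralSeries R L M 2).toSubmodule ≤ N ↔ ∀ (x y : L) (m : M), ⁅x, ⁅y, m⁆⁆ ∈ N := by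
  rw [lowerCentralSeries_succ_le_iff]
  exact forall_congr' fun x => lowerCentralSeries_one_le_iff (N := N.comap (toEnd R L M x))

theorem map_mem_lowerCentralSeries {L' : Type*} [LieRing L'] [LieAlgebra R L'] (f : L →ₗ⁅R⁆ L')
    {i : ℕ} {x : L} (hx : x ∈ lowerCentralSeries R L L i) : f x ∈ lowerCentralSeries R L' L' i :=
  LieIdeal.map_lowerCentralSeries_le i (LieIdeal.mem_map hx)

theorem mem_center_of_mem_lowerCentralSeries {i : ℕ} (h : lowerCentralSeries R L L (i + 1) = ⊥)
    {z : L} (hz : z ∈ lowerCentralSeries R L L i) : z ∈ LieAlgebra.center R L := by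
  refine (mem_maxTrivSubmodule R L L z).2 fun x => ?_
  rw [← LieSubmodule.mem_bot (R := R) (L := L), ← h]
  exact lie_mem_lowerCentralSeries_succ x hz

end LowerCentralSeries

/-! ### Brackets in coordinates and Zariski open sets -/

open Polynomial in
theorem exists_ne_zero_eval_add_smul_ne_zero {R σ : Type*} [CommRing R] [IsDomain R]
    [Infinite R] {p : MvPolynomial σ R} {c : σ → R} (hp : MvPolynomial.eval c p ≠ 0) (d : σ → R) :
    ∃ t : R, t ≠ 0 ∧ MvPolynomial.eval (c + t • d) p ≠ 0 := by
  let line : R[X] := MvPolynomial.aeval (fun i => C (c i) + X * C (d i)) p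
  have eval_line (t : R) : line.eval t = MvPolynomial.eval (c + t • d) p := by
    have eval_comp_aeval : (evalRingHom t).comp (MvPolynomial.aeval fun i => C (c i) + X * C (d i) :
        MvPolynomial σ R →ₐ[R] R[X]).toRingHom = MvPolynomial.eval (c + t • d) := by
      ext i
      · simp
      · simpa using mul_comm _ _
    exact RingHom.congr_fun eval_comp_aeval p
  by_contra! hvanish
  have line_mul_X_eq_zero : line * X = 0 := Polynomial.funext fun t => by
    by_cases ht : t = 0
    · simp [ht]
    · simp [eval_line, hvanish t ht]
  have line_eq_zero : line = 0 := (mul_eq_zero.1 line_mul_X_eq_zero).resolve_right X_ne_zero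
  exact hp (by simpa [line_eq_zero] using (eval_line 0).symm)

namespace BilinearBracket

variable {K : Type*} [Field K] {n : ℕ}

theorem IsZariskiOpenIn.exists_ne_zero_add_smul_mem [Infinite K] {X U : Set (BilinearBracket K n)}
    (hU : IsZariskiOpenIn X U) {μ ν : BilinearBracket K n} (hμ : μ ∈ U)
    (hline : ∀ t : K, μ + t • ν ∈ X) : ∃ t : K, t ≠ 0 ∧ μ + t • ν ∈ U := by
  obtain ⟨S, rfl⟩ := hU
  obtain ⟨p, hpS, hp⟩ : ∃ p ∈ S, MvPolynomial.eval μ.structureConstants p ≠ 0 := by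
    simpa using hμ.2
  obtain ⟨t, ht, hpt⟩ := exists_ne_zero_eval_add_smul_ne_zero hp ν.structureConstants
  exact ⟨t, ht, hline t, fun hzero => hpt (hzero p hpS)⟩

theorem act_eq_iff {g : (Fin n → K) ≃ₗ[K] (Fin n → K)} {μ ν : BilinearBracket K n} :
    act g μ = ν ↔ ∀ x y, g (μ x y) = ν (g x) (g y) := by
  refine ⟨by rintro rfl x y; simp [act], fun h => LinearMap.ext₂ fun x y => ?_⟩
  simpa [act] using h (g.symm x) (g.symm y)

variable {L : Type*} [LieRing L] [LieAlgebra K L] (b : Module.Basis (Fin n) K L)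

theorem ofBasis_apply (x y : Fin n → K) :
    ofBasis b x y = b.equivFun ⁅b.equivFun.symm x, b.equivFun.symm y⁆ := rfl

theorem isLieBracket_ofBasis : (ofBasis b).IsLieBracket := by
  refine ⟨fun x => by simp [ofBasis_apply], fun x y z => ?_⟩
  simp only [ofBasis_apply, LinearEquiv.symm_apply_apply, ← map_add, lie_jacobi, map_zero]

theorem centralSeries_ofBasis (i : ℕ) :
    (ofBasis b).centralSeries i =
      (LieModule.lowerCentralSeries K L L i).toSubmodule.map b.equivFun.toLinearMap := by
  induction i with
  | zero => simp [centralSeries]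
  | succ i ih =>
    apply le_antisymm
    · rw [centralSeries, Submodule.map₂_le, ih]
      rintro x - _ ⟨m, hm, rfl⟩
      refine ⟨⁅b.equivFun.symm x, m⁆, lie_mem_lowerCentralSeries_succ _ hm, ?_⟩
      simp [ofBasis_apply]
    · rw [Submodule.map_le_iff_le_comap, lowerCentralSeries_succ_le_iff]
      intro x m hm
      have hxm : b.equivFun ⁅x, m⁆ = ofBasis b (b.equivFun x) (b.equivFun m) := by
        simp [ofBasis_apply]
      rw [Submodule.mem_comap, LinearEquiv.coe_coe, hxm, centralSeries]
      exact Submodule.apply_mem_map₂ _ Submodule.mem_top (ih ▸ Submodule.mem_map_of_mem hm)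

theorem ofBasis_mem_nilpotentVariety_iff {k : ℕ} :
    ofBasis b ∈ nilpotentVariety K n k ↔ LieModule.lowerCentralSeries K L L k = ⊥ := by
  simp [nilpotentVariety, isLieBracket_ofBasis, centralSeries_ofBasis, Submodule.map_eq_bot_iff]

theorem ofBasis_mem_orbit_ofBasis_iff {L' : Type*} [LieRing L'] [LieAlgebra K L']
    (b' : Module.Basis (Fin n) K L') :
    ofBasis b' ∈ (ofBasis b).orbit ↔ Nonempty (L ≃ₗ⁅K⁆ L') := by
  constructor
  · rintro ⟨g, hg⟩
    refine ⟨{ b.equivFun.trans (g.trans b'.equivFun.symm) with map_lie' := fun {x y} => ?_ }⟩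
    have equivFun_lie := act_eq_iff.1 hg (b.equivFun x) (b.equivFun y)
    simp only [ofBasis_apply, LinearEquiv.symm_apply_apply] at equivFun_lie
    exact (LinearEquiv.symm_apply_eq b'.equivFun).2 equivFun_lie
  · rintro ⟨f⟩
    refine ⟨b.equivFun.symm.trans (f.toLinearEquiv.trans b'.equivFun), act_eq_iff.2 fun x y => ?_⟩
    simp only [ofBasis_apply, LinearEquiv.trans_apply, LinearEquiv.symm_apply_apply]
    exact congrArg b'.equivFun (f.map_lie _ _)

end BilinearBracket

/-! ### Central deformations -/

/-- A `2`-cocycle on `L` with values in the centre of `L`, vanishing on `⁅L, L⁆` and on its own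
values. These are the conditions under which `⁅x, y⁆ + t • form x y` has the same threefold brackets
as `⁅x, y⁆`, so that it is a Lie bracket for every scalar `t`. -/
structure CentralCocycle (R L : Type*) [CommRing R] [LieRing L] [LieAlgebra R L] where
  /-- The underlying bilinear map. -/
  form : L →ₗ[R] L →ₗ[R] L
  isAlt : form.IsAlt
  lie_form : ∀ x y z : L, ⁅x, form y z⁆ = 0
  form_lie : ∀ x y z : L, form x ⁅y, z⁆ = 0
  form_form : ∀ x y z : L, form x (form y z) = 0

namespace CentralCocycle

variable {R L : Type*} [CommRing R] [LieRing L] [LieAlgebra R L]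

section OfCharacters

attribute [local instance] LieRing.ofAssociativeRing

/-- The cocycle `(α ∧ β) ⊗ z` given by two characters of `L` and a central element on which both of
them vanish. -/
def ofCharacters (α β : LieAlgebra.LieCharacter R L) (z : L) (hz : z ∈ LieAlgebra.center R L)
    (hαz : α z = 0) (hβz : β z = 0) : CentralCocycle R L where
  form := α.toLinearMap.smulRight (β.toLinearMap.smulRight z) -
    β.toLinearMap.smulRight (α.toLinearMap.smulRight z)
  isAlt x := sub_eq_zero.2 (smul_comm (α x) (β x) z)
  lie_form x y w := by
    have hxz : ⁅x, z⁆ = 0 := (LieModule.mem_maxTrivSubmodule R L L z).1 hz x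
    simp [hxz]
  form_lie x y w := by simp
  form_form x y w := by simp [hαz, hβz]

theorem ofCharacters_form_apply (α β : LieAlgebra.LieCharacter R L) (z : L)
    (hz : z ∈ LieAlgebra.center R L) (hαz : α z = 0) (hβz : β z = 0) (x y : L) :
    (ofCharacters α β z hz hαz hβz).form x y = α x • β y • z - β x • α y • z := rfl

end OfCharacters

theorem form_eq_zero_of_mem_lowerCentralSeries (φ : CentralCocycle R L) {i : ℕ} (hi : 1 ≤ i) (x : L)
    {m : L} (hm : m ∈ LieModule.lowerCentralSeries R L L i) : φ.form x m = 0 :=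
  (lowerCentralSeries_one_le_iff (N := LinearMap.ker (φ.form x))).2 (φ.form_lie x)
    (LieModule.antitone_lowerCentralSeries R L L hi hm)

/-- The Lie algebra with underlying module `L` and bracket `⁅x, y⁆ + t • φ.form x y`. -/
def Deformation (_φ : CentralCocycle R L) (_t : R) : Type _ := L

namespace Deformation

variable {φ : CentralCocycle R L} {t : R}

instance : AddCommGroup (φ.Deformation t) := inferInstanceAs (AddCommGroup L)

instance : Module R (φ.Deformation t) := inferInstanceAs (Module R L)

variable (φ t) in
/-- The identity map from a deformation to the Lie algebra that it deforms. -/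
def equiv : φ.Deformation t ≃ₗ[R] L := LinearEquiv.refl R L

instance : Bracket (φ.Deformation t) (φ.Deformation t) :=
  ⟨fun x y => (equiv φ t).symm
    (⁅equiv φ t x, equiv φ t y⁆ + t • φ.form (equiv φ t x) (equiv φ t y))⟩

theorem equiv_lie (x y : φ.Deformation t) :
    equiv φ t ⁅x, y⁆ = ⁅equiv φ t x, equiv φ t y⁆ + t • φ.form (equiv φ t x) (equiv φ t y) := rfl

theorem equiv_lie_lie (x y z : φ.Deformation t) :
    equiv φ t ⁅x, ⁅y, z⁆⁆ = ⁅equiv φ t x, ⁅equiv φ t y, equiv φ t z⁆⁆ := by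
  simp [equiv_lie, φ.lie_form, φ.form_lie, φ.form_form]

instance : LieRing (φ.Deformation t) where
  add_lie x y z := (equiv φ t).injective <| by
    simp only [equiv_lie, map_add, add_lie, LinearMap.add_apply, smul_add]; abel
  lie_add x y z := (equiv φ t).injective <| by
    simp only [equiv_lie, map_add, lie_add, smul_add]; abel
  lie_self x := (equiv φ t).injective <| by simp [equiv_lie, φ.isAlt (equiv φ t x)]
  leibniz_lie x y z := (equiv φ t).injective <| by
    have equiv_lie_lie_left :
        equiv φ t ⁅⁅x, y⁆, z⁆ = ⁅⁅equiv φ t x, equiv φ t y⁆, equiv φ t z⁆ := by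
      rw [← lie_skew, equiv_lie, ← φ.isAlt.neg (equiv φ t z), smul_neg, ← lie_skew, ← neg_add,
        ← equiv_lie, equiv_lie_lie]
    rw [map_add, equiv_lie_lie, equiv_lie_lie, equiv_lie_lie_left, leibniz_lie]

instance : LieAlgebra R (φ.Deformation t) where
  lie_smul c x y := (equiv φ t).injective <| by
    simp only [equiv_lie, map_smul, lie_smul, smul_add, smul_comm t c]

theorem lowerCentralSeries_two_eq_comap :
    (LieModule.lowerCentralSeries R (φ.Deformation t) (φ.Deformation t) 2).toSubmodule =
      (LieModule.lowerCentralSeries R L L 2).toSubmodule.comap (equiv φ t).toLinearMap := by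
  refine le_antisymm (lowerCentralSeries_two_le_iff.2 fun x y z => ?_) ?_
  · rw [Submodule.mem_comap, LinearEquiv.coe_coe, equiv_lie_lie]
    exact lowerCentralSeries_two_le_iff.1 le_rfl _ _ _
  · rw [Submodule.comap_equiv_eq_map_symm, Submodule.map_le_iff_le_comap]
    refine lowerCentralSeries_two_le_iff.2 fun x y z => ?_
    have equiv_symm_lie_lie : (equiv φ t).symm ⁅x, ⁅y, z⁆⁆ =
        ⁅(equiv φ t).symm x, ⁅(equiv φ t).symm y, (equiv φ t).symm z⁆⁆ :=
      (equiv φ t).injective (by simp [equiv_lie_lie])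
    rw [Submodule.mem_comap, LinearEquiv.coe_coe, equiv_symm_lie_lie]
    exact lowerCentralSeries_two_le_iff.1 le_rfl _ _ _

theorem equiv_lie_of_mem {i : ℕ} (hi : 1 ≤ i) (x : φ.Deformation t) {y : φ.Deformation t}
    (hy : equiv φ t y ∈ LieModule.lowerCentralSeries R L L i) :
    equiv φ t ⁅x, y⁆ = ⁅equiv φ t x, equiv φ t y⁆ := by
  rw [equiv_lie, φ.form_eq_zero_of_mem_lowerCentralSeries hi _ hy, smul_zero, add_zero]

theorem lowerCentralSeries_eq_comap {i : ℕ} (hi : 2 ≤ i) :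
    (LieModule.lowerCentralSeries R (φ.Deformation t) (φ.Deformation t) i).toSubmodule =
      (LieModule.lowerCentralSeries R L L i).toSubmodule.comap (equiv φ t).toLinearMap := by
  induction i, hi using Nat.le_induction with
  | base => exact lowerCentralSeries_two_eq_comap
  | succ i hi ih =>
    refine le_antisymm (lowerCentralSeries_succ_le_iff.2 fun x m hm => ?_) ?_
    · rw [Submodule.mem_comap, LinearEquiv.coe_coe,
        equiv_lie_of_mem (one_le_two.trans hi) x (ih.le hm)]
      exact lie_mem_lowerCentralSeries_succ _ (ih.le hm)
    · rw [Submodule.comap_equiv_eq_map_symm, Submodule.map_le_iff_le_comap]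
      refine lowerCentralSeries_succ_le_iff.2 fun x m hm => ?_
      have equiv_symm_lie :
          (equiv φ t).symm ⁅x, m⁆ = ⁅(equiv φ t).symm x, (equiv φ t).symm m⁆ :=
        (equiv φ t).injective (by
          rw [equiv_lie_of_mem (one_le_two.trans hi) _ (by simpa using hm)]; simp)
      rw [Submodule.mem_comap, LinearEquiv.coe_coe, equiv_symm_lie]
      exact lie_mem_lowerCentralSeries_succ _ (ih.ge (by simpa using hm))

end Deformation

end CentralCocycle

open CentralCocycle Deformation BilinearBracket in
theorem IsKRigid.exists_lieEquiv_deformation {K L : Type*} [Field K] [Infinite K] [LieRing L]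
    [LieAlgebra K L] [Module.Finite K L] {k : ℕ} (h : IsKRigid K k L) (hk : 2 ≤ k)
    (φ : CentralCocycle K L) : ∃ t : K, t ≠ 0 ∧ Nonempty (L ≃ₗ⁅K⁆ φ.Deformation t) := by
  obtain ⟨b, hb, hopen⟩ := h
  let b' (t : K) := b.map (equiv φ t).symm
  let ν : BilinearBracket K (Module.finrank K L) :=
    (φ.form.compl₁₂ b.equivFun.symm.toLinearMap b.equivFun.symm.toLinearMap).compr₂
      b.equivFun.toLinearMap
  have ofBasis_deformation (t : K) : ofBasis (b' t) = ofBasis b + t • ν :=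
    LinearMap.ext₂ fun x y => by
      rw [ofBasis_apply, Module.Basis.map_equivFun]
      simp [ofBasis_apply, equiv_lie, ν, -Module.Basis.equivFun_apply,
        -Module.Basis.equivFun_symm_apply]
  have mem_nilpotentVariety (t : K) : ofBasis b + t • ν ∈ nilpotentVariety K _ k := by
    rw [ofBasis_mem_nilpotentVariety_iff] at hb
    rw [← ofBasis_deformation, ofBasis_mem_nilpotentVariety_iff, ← LieSubmodule.toSubmodule_eq_bot,
      lowerCentralSeries_eq_comap hk, hb]
    simp
  have mem_orbit_self : ofBasis b ∈ (ofBasis b).orbit :=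
    (ofBasis_mem_orbit_ofBasis_iff b b).2 ⟨LieEquiv.refl⟩
  obtain ⟨t, ht, hmem⟩ := hopen.exists_ne_zero_add_smul_mem mem_orbit_self mem_nilpotentVariety
  rw [← ofBasis_deformation, ofBasis_mem_orbit_ofBasis_iff] at hmem
  exact ⟨t, ht, hmem⟩

/-! ### Filiform Lie algebras -/

section Filiform

attribute [local instance] LieRing.ofAssociativeRing

variable {K R : Type*} [CommRing K] [CommRing R] [Algebra K R]

variable (K) in
/-- Multiplication by `ε`, as a derivation of the abelian Lie algebra `R`. -/
def mulLieDerivation (ε : R) : LieDerivation K R R where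
  toLinearMap := LinearMap.mulLeft K ε
  leibniz' x y := by simp [LieRing.of_associative_ring_bracket, mul_comm]

variable (K) in
/-- The abelian Lie algebra `K` acting on the abelian Lie algebra `R`, the unit acting as
multiplication by `ε`. -/
def filiformAction (ε : R) : K →ₗ⁅K⁆ LieDerivation K R R where
  toLinearMap := LinearMap.toSpanSingleton K _ (mulLieDerivation K ε)
  map_lie' {a b} := by
    ext x
    simp [mulLieDerivation, LieRing.of_associative_ring_bracket, mul_comm]

theorem filiformAction_apply_apply (ε : R) (a : K) (p : R) :
    filiformAction K ε a p = a • (ε * p) := rfl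

variable (K) in
/-- `R ⊕ K` with `⁅(p, a), (q, b)⁆ = (ε (a q - b p), 0)`. For `R = K[ε] / (ε ^ k)` this is the
standard filiform Lie algebra of nilpotency class `k`. -/
abbrev FiliformLieAlgebra (ε : R) : Type _ := R ⋊⁅filiformAction K ε⁆ K

open LieAlgebra SemiDirectSum

namespace FiliformLieAlgebra

variable {ε : R}

theorem lie_eq (x y : FiliformLieAlgebra K ε) :
    ⁅x, y⁆ = ⟨ε * (x.right • y.left - y.right • x.left), 0⟩ := by
  simp [filiformAction_apply_apply, LieRing.of_associative_ring_bracket, mul_comm, mul_sub]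

theorem lowerCentralSeries_succ_le (ε : R) (i : ℕ) :
    (LieModule.lowerCentralSeries K (FiliformLieAlgebra K ε) (FiliformLieAlgebra K ε)
      (i + 1)).toSubmodule ≤ LinearMap.range
        ((inl (filiformAction K ε)).toLinearMap ∘ₗ LinearMap.mulLeft K (ε ^ (i + 1))) := by
  induction i with
  | zero =>
    refine lowerCentralSeries_one_le_iff.2 fun x y => ⟨x.right • y.left - y.right • x.left, ?_⟩
    rw [lie_eq]
    simp
  | succ i ih =>
    refine lowerCentralSeries_succ_le_iff.2 fun x m hm => ?_
    obtain ⟨p, rfl⟩ := ih hm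
    exact ⟨x.right • p, by rw [lie_eq]; simp [pow_succ']⟩

theorem lowerCentralSeries_eq_bot {k : ℕ} (hk : k ≠ 0) (hε : ε ^ k = 0) :
    LieModule.lowerCentralSeries K (FiliformLieAlgebra K ε) (FiliformLieAlgebra K ε) k = ⊥ := by
  obtain ⟨i, rfl⟩ := Nat.exists_eq_succ_of_ne_zero hk
  have := lowerCentralSeries_succ_le (K := K) ε i
  simpa [hε] using this

end FiliformLieAlgebra

end Filiform

section TruncatedPolynomial

open Polynomial

variable {R : Type*} [CommRing R] {n : ℕ}

theorem root_X_pow_pow_eq_zero : (AdjoinRoot.root (X ^ n : R[X])) ^ n = 0 := by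
  rw [← AdjoinRoot.mk_X, ← map_pow, AdjoinRoot.mk_self]

theorem root_X_pow_pow_ne_zero [IsDomain R] {m : ℕ} (hmn : m < n) :
    (AdjoinRoot.root (X ^ n : R[X])) ^ m ≠ 0 := by
  rw [← AdjoinRoot.mk_X, ← map_pow, Ne, AdjoinRoot.mk_eq_zero,
    pow_dvd_pow_iff X_ne_zero not_isUnit_X]
  exact hmn.not_ge

end TruncatedPolynomial

/-! ### Graph Lie algebras -/

namespace GraphLieAlgebra

section QuotientLift

variable {K L M : Type*} [Field K] [LieRing L] [LieAlgebra K L] [LieRing M] [LieAlgebra K M]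

/-- The homomorphism out of a quotient induced by a homomorphism that vanishes on the ideal. -/
def quotientLift (I : LieIdeal K L) (f : L →ₗ⁅K⁆ M) (h : I ≤ f.ker) : L ⧸ I →ₗ⁅K⁆ M where
  toLinearMap := I.toSubmodule.liftQ f fun _ hx => h hx
  map_lie' {x y} := by
    obtain ⟨x, rfl⟩ := proj_surjective I x
    obtain ⟨y, rfl⟩ := proj_surjective I y
    exact f.map_lie x y

end QuotientLift

variable (K : Type*) [Field K] (k : ℕ) {V : Type*} (G : SimpleGraph V)

/-- The generator of `𝔤(k, G)` given by a vertex. -/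
noncomputable def of (v : V) : GraphLieAlgebra K k G :=
  proj (nonEdgeIdeal K k G) (FreeNilpotentLieAlgebra.of K k v)

theorem lieSpan_range_of : LieSubalgebra.lieSpan K _ (Set.range (of K k G)) = ⊤ := by
  let π := (proj (nonEdgeIdeal K k G)).comp (proj _)
  have comap_eq_top : (LieSubalgebra.lieSpan K _ (Set.range (of K k G))).comap π = ⊤ :=
    subalgebra_eq_top _ fun v => LieSubalgebra.subset_lieSpan ⟨v, rfl⟩
  refine eq_top_iff.2 fun x _ => ?_
  obtain ⟨y, rfl⟩ := (proj_surjective (nonEdgeIdeal K k G)).comp (proj_surjective _) x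
  exact comap_eq_top.ge (LieSubalgebra.mem_top y)

variable {K k G}

theorem lie_of_of_eq_zero {v w : V} (h : ¬ G.Adj v w) : ⁅of K k G v, of K k G w⁆ = 0 := by
  by_cases hvw : v = w
  · rw [hvw, lie_self]
  · rw [of, of, ← LieHom.map_lie]
    exact (LieSubmodule.Quotient.mk_eq_zero _).2
      (LieSubmodule.subset_lieSpan ⟨v, w, hvw, h, rfl⟩)

theorem isLieAbelian_bot : IsLieAbelian (GraphLieAlgebra K k (⊥ : SimpleGraph V)) := by
  rw [← lie_abelian_iff_equiv_lie_abelian LieSubalgebra.topEquiv (R := K), ← lieSpan_range_of,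
    LieSubalgebra.isLieAbelian_lieSpan_iff]
  rintro _ ⟨v, rfl⟩ _ ⟨w, rfl⟩
  exact lie_of_of_eq_zero (by simp)

theorem linearMap_ext {M : Type*} [AddCommGroup M] [Module K M]
    {f g : GraphLieAlgebra K k G →ₗ[K] M} (hof : ∀ v, f (of K k G v) = g (of K k G v))
    (hlie : ∀ x y : GraphLieAlgebra K k G, f ⁅x, y⁆ = g ⁅x, y⁆) : f = g := by
  let eqSubalgebra : LieSubalgebra K (GraphLieAlgebra K k G) :=
    { LinearMap.eqLocus f g with lie_mem' := fun _ _ => hlie _ _ }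
  have top_le : ⊤ ≤ eqSubalgebra := by
    rw [← lieSpan_range_of, LieSubalgebra.lieSpan_le]
    rintro _ ⟨v, rfl⟩
    exact hof v
  exact LinearMap.ext fun x => top_le (LieSubalgebra.mem_top x)

section Lift

variable {M : Type*} [LieRing M] [LieAlgebra K M]

/-- The universal property of `𝔤(k, G)` among the at most `k`-step nilpotent Lie algebras. -/
noncomputable def lift (hM : LieModule.lowerCentralSeries K M M k = ⊥) (m : V → M)
    (hm : ∀ v w, ¬ G.Adj v w → ⁅m v, m w⁆ = 0) : GraphLieAlgebra K k G →ₗ⁅K⁆ M :=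
  quotientLift _
    (quotientLift _ (FreeLieAlgebra.lift K m) fun x hx => by
      simpa [hM] using map_mem_lowerCentralSeries (FreeLieAlgebra.lift K m) hx) <| by
    rw [nonEdgeIdeal, LieSubmodule.lieSpan_le]
    rintro _ ⟨v, w, -, hvw, rfl⟩
    rw [SetLike.mem_coe, LieHom.mem_ker, LieHom.map_lie]
    exact (congrArg₂ _ (FreeLieAlgebra.lift_of_apply m v) (FreeLieAlgebra.lift_of_apply m w)).trans
      (hm v w hvw)

theorem lift_of (hM : LieModule.lowerCentralSeries K M M k = ⊥) (m : V → M)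
    (hm : ∀ v w, ¬ G.Adj v w → ⁅m v, m w⁆ = 0) (v : V) : lift hM m hm (of K k G v) = m v :=
  FreeLieAlgebra.lift_of_apply m v

end Lift

attribute [local instance] LieRing.ofAssociativeRing

section Coord

variable [NeZero k] [DecidableEq V]

variable (K k G) in
/-- The coordinate of an element of `𝔤(k, G)` modulo brackets along the generator `v`. -/
noncomputable def coord (v : V) : LieAlgebra.LieCharacter K (GraphLieAlgebra K k G) :=
  lift (lowerCentralSeries_eq_bot_of_le NeZero.one_le
      ((LieModule.trivial_iff_lower_central_eq_bot K K K).1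
        (isMulCommutative_iff_isLieAbelian.1 inferInstance)))
    (Pi.single v 1) fun _ _ _ => sub_eq_zero.2 (mul_comm _ _)

theorem coord_of (v w : V) : coord K k G v (of K k G w) = (Pi.single v 1 : V → K) w :=
  lift_of _ _ _ w

variable [Fintype V]

/-- The projection of `𝔤(k, G)` onto the span of the generators whose kernel is `⁅𝔤, 𝔤⁆`. -/
noncomputable def linearPart : GraphLieAlgebra K k G →ₗ[K] GraphLieAlgebra K k G :=
  ∑ v, (coord K k G v).toLinearMap.smulRight (of K k G v)

theorem linearPart_apply (x : GraphLieAlgebra K k G) :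
    linearPart x = ∑ v, coord K k G v x • of K k G v := by
  simp [linearPart]

theorem map_linearPart {M : Type*} [AddCommGroup M] [Module K M]
    {f : GraphLieAlgebra K k G →ₗ[K] M} (hf : ∀ x y : GraphLieAlgebra K k G, f ⁅x, y⁆ = 0)
    (x : GraphLieAlgebra K k G) : f (linearPart x) = f x := by
  suffices f ∘ₗ linearPart = f from LinearMap.congr_fun this x
  refine linearMap_ext (fun v => ?_) fun x y => ?_
  · simp [linearPart_apply, coord_of, Pi.single_apply]
  · simp [linearPart_apply, hf]

end Coord

section ToFiliform

variable [NeZero k] [DecidableEq V] {R : Type*} [CommRing R] [Algebra K R] {ε : R} {u v : V}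

/-- The homomorphism to a filiform Lie algebra given by an edge `u v`, under which `u` acts
as multiplication by `ε` and `v` becomes `1`, while the other vertices are sent to zero. -/
noncomputable def toFiliform (hε : ε ^ k = 0) (huv : G.Adj u v) :
    GraphLieAlgebra K k G →ₗ⁅K⁆ FiliformLieAlgebra K ε :=
  lift (FiliformLieAlgebra.lowerCentralSeries_eq_bot (NeZero.ne k) hε)
    (fun i => ⟨(Pi.single v 1 : V → R) i, (Pi.single u 1 : V → K) i⟩) fun i j hij => by
      have single_smul_single {i j : V} (hij : ¬ G.Adj i j) :
          (Pi.single u 1 : V → K) i • (Pi.single v 1 : V → R) j = 0 := by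
        by_contra hne
        have hi : i = u := by by_contra hi; simp [hi] at hne
        have hj : j = v := by by_contra hj; simp [hj] at hne
        exact hij (hi ▸ hj ▸ huv)
      rw [FiliformLieAlgebra.lie_eq, single_smul_single hij,
        single_smul_single (mt G.adj_symm hij)]
      simp

variable (hε : ε ^ k = 0) (huv : G.Adj u v)

theorem toFiliform_of (i : V) : toFiliform hε huv (of K k G i) =
    ⟨(Pi.single v 1 : V → R) i, (Pi.single u 1 : V → K) i⟩ :=
  lift_of _ _ _ i

theorem right_toFiliform (x : GraphLieAlgebra K k G) :
    (toFiliform hε huv x).right = coord K k G u x := by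
  let f := (LieAlgebra.SemiDirectSum.projr (filiformAction K ε)).comp (toFiliform hε huv)
  suffices f.toLinearMap = (coord K k G u).toLinearMap from LinearMap.congr_fun this x
  refine linearMap_ext (fun i => ?_) fun x y => ?_
  · simp [f, toFiliform_of, coord_of]
  · rw [LieHom.coe_toLinearMap, LieHom.coe_toLinearMap, LieAlgebra.lieCharacter_apply_lie f,
      LieAlgebra.lieCharacter_apply_lie]

theorem toFiliform_lie_eq_zero {x y : GraphLieAlgebra K k G} (hx : coord K k G u x = 0)
    (hy : coord K k G u y = 0) : toFiliform hε huv ⁅x, y⁆ = 0 := by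
  rw [LieHom.map_lie, FiliformLieAlgebra.lie_eq, right_toFiliform, right_toFiliform, hx, hy]
  simp

theorem mul_left_toFiliform (hε_sq : ε ^ 2 = 0) (x : GraphLieAlgebra K k G) :
    ε * (toFiliform hε huv x).left = coord K k G v x • ε := by
  let f := LinearMap.mulLeft K ε ∘ₗ
    LieAlgebra.SemiDirectSum.projl (filiformAction K ε) ∘ₗ (toFiliform hε huv).toLinearMap
  suffices f = (coord K k G v).toLinearMap.smulRight ε from LinearMap.congr_fun this x
  refine linearMap_ext (fun i => ?_) fun x y => ?_
  · simp [f, toFiliform_of, coord_of, Pi.single_apply]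
  · simp only [f, LinearMap.comp_apply, LieHom.coe_toLinearMap, LieHom.map_lie,
      FiliformLieAlgebra.lie_eq]
    simp [← mul_assoc, ← sq, hε_sq]

theorem toFiliform_iterate (n : ℕ) :
    toFiliform hε huv ((LieModule.toEnd K _ _ (of K k G u))^[n] (of K k G v)) = ⟨ε ^ n, 0⟩ := by
  induction n with
  | zero => simp [toFiliform_of, huv.ne']
  | succ n ih =>
    rw [Function.iterate_succ_apply', LieModule.toEnd_apply_apply, LieHom.map_lie, ih,
      toFiliform_of, FiliformLieAlgebra.lie_eq]
    simp [pow_succ']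

end ToFiliform

section LinearPart

variable [k.AtLeastTwo] [DecidableEq V]

theorem coord_mul_coord_comm {u v : V} (huv : G.Adj u v) {x y : GraphLieAlgebra K k G}
    (h : ⁅x, y⁆ ∈ LieModule.lowerCentralSeries K (GraphLieAlgebra K k G)
      (GraphLieAlgebra K k G) 2) :
    coord K k G u x * coord K k G v y = coord K k G u y * coord K k G v x := by
  let ε : AdjoinRoot (Polynomial.X ^ 2 : Polynomial K) := AdjoinRoot.root _
  have hε_sq : ε ^ 2 = 0 := root_X_pow_pow_eq_zero
  have hε_ne_zero : ε ≠ 0 := by simpa using root_X_pow_pow_ne_zero one_lt_two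
  let π := toFiliform (K := K) (pow_eq_zero_of_le (Nat.AtLeastTwo.prop (n := k)) hε_sq) huv
  have map_lie_eq_zero : ⁅π x, π y⁆ = 0 := by
    have map_lie_mem := map_mem_lowerCentralSeries π h
    rwa [FiliformLieAlgebra.lowerCentralSeries_eq_bot two_ne_zero hε_sq, LieSubmodule.mem_bot,
      LieHom.map_lie] at map_lie_mem
  have minor_smul_eq_zero :
      (coord K k G u x * coord K k G v y - coord K k G u y * coord K k G v x) • ε = 0 := by
    have left_eq_zero := congrArg LieAlgebra.SemiDirectSum.left map_lie_eq_zero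
    rw [FiliformLieAlgebra.lie_eq] at left_eq_zero
    simpa [π, right_toFiliform, mul_sub, mul_left_toFiliform _ huv hε_sq, sub_smul, mul_smul]
      using left_eq_zero
  exact sub_eq_zero.1 ((smul_eq_zero.1 minor_smul_eq_zero).resolve_right hε_ne_zero)

theorem lie_linearPart_linearPart_eq_zero [Fintype V] {x y : GraphLieAlgebra K k G}
    (h : ⁅x, y⁆ ∈ LieModule.lowerCentralSeries K (GraphLieAlgebra K k G)
      (GraphLieAlgebra K k G) 2) :
    ⁅linearPart x, linearPart y⁆ = 0 := by
  have lie_eq_sum : ⁅linearPart x, linearPart y⁆ = ∑ p : V × V,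
      (coord K k G p.1 x * coord K k G p.2 y) • ⁅of K k G p.1, of K k G p.2⁆ := by
    simp [linearPart_apply, sum_lie_sum, Fintype.sum_prod_type, smul_smul, mul_comm]
  have add_swap_eq_zero (v w : V) :
      (coord K k G v x * coord K k G w y) • ⁅of K k G v, of K k G w⁆ +
        (coord K k G w x * coord K k G v y) • ⁅of K k G w, of K k G v⁆ = 0 := by
    by_cases hvw : G.Adj v w
    · rw [coord_mul_coord_comm hvw h, ← lie_skew (of K k G w), mul_comm (coord K k G v y), smul_neg,
        add_neg_cancel]
    · simp [lie_of_of_eq_zero hvw, lie_of_of_eq_zero (mt G.adj_symm hvw)]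
  rw [lie_eq_sum]
  refine Finset.sum_involution (fun p _ => p.swap) (fun p _ => add_swap_eq_zero p.1 p.2) ?_
    (fun _ _ => Finset.mem_univ _) fun _ _ => Prod.swap_swap _
  rintro ⟨v, w⟩ - hne hswap
  obtain rfl : w = v := congrArg Prod.fst hswap
  simp at hne

end LinearPart

/-! ### Non-rigidity -/

open CentralCocycle Deformation in
theorem exists_lie_add_smul_form_eq_zero [k.AtLeastTwo] [DecidableEq V] [Finite V]
    {φ : CentralCocycle K (GraphLieAlgebra K k G)} {t : K}
    (f : GraphLieAlgebra K k G ≃ₗ⁅K⁆ φ.Deformation t)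
    (hφ : ∀ i x y, coord K k G i (φ.form x y) = 0) {x y : GraphLieAlgebra K k G}
    (hxy : ⁅x, y⁆ + t • φ.form x y ∈ LieModule.lowerCentralSeries K (GraphLieAlgebra K k G)
      (GraphLieAlgebra K k G) 2) :
    ∃ a b : GraphLieAlgebra K k G, (∀ i, coord K k G i a = coord K k G i x) ∧
      (∀ i, coord K k G i b = coord K k G i y) ∧ ⁅a, b⁆ + t • φ.form a b = 0 := by
  have := Fintype.ofFinite V
  let e := equiv φ t
  let x' := f.symm (e.symm x)
  let y' := f.symm (e.symm y)
  have lie_mem : ⁅x', y'⁆ ∈ LieModule.lowerCentralSeries K (GraphLieAlgebra K k G)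
      (GraphLieAlgebra K k G) 2 := by
    rw [← LieEquiv.map_lie]
    refine map_mem_lowerCentralSeries f.symm.toLieHom (lowerCentralSeries_two_eq_comap.ge ?_)
    simpa [equiv_lie, e] using hxy
  have coord_linearPart (i : V) (z : GraphLieAlgebra K k G) :
      coord K k G i (e (f (linearPart z))) = coord K k G i (e (f z)) := by
    refine map_linearPart (f := (coord K k G i).toLinearMap ∘ₗ e.toLinearMap ∘ₗ
      f.toLinearEquiv.toLinearMap) (fun z w => ?_) z
    change coord K k G i (e (f ⁅z, w⁆)) = 0
    rw [LieEquiv.map_lie, equiv_lie, map_add, map_smul, hφ, LieAlgebra.lieCharacter_apply_lie,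
      smul_zero, add_zero]
  refine ⟨e (f (linearPart x')), e (f (linearPart y')), fun i => ?_, fun i => ?_, ?_⟩
  · simp [coord_linearPart, x']
  · simp [coord_linearPart, y']
  · rw [← equiv_lie, ← LieEquiv.map_lie, lie_linearPart_linearPart_eq_zero lie_mem, map_zero,
      map_zero]

theorem lie_add_smul_iterate_ne_zero [NeZero k] [DecidableEq V] {u v : V} (huv : G.Adj u v)
    {a b : GraphLieAlgebra K k G} (ha : coord K k G u a = 0) (hb : coord K k G u b = 0) {t : K}
    (ht : t ≠ 0) {n : ℕ} (hn : n < k) :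
    ⁅a, b⁆ + t • (LieModule.toEnd K _ _ (of K k G u))^[n] (of K k G v) ≠ 0 := by
  intro hzero
  have map_eq_zero := congrArg (toFiliform (root_X_pow_pow_eq_zero (R := K)) huv) hzero
  rw [map_add, toFiliform_lie_eq_zero _ _ ha hb, map_smul, toFiliform_iterate, map_zero,
    zero_add] at map_eq_zero
  have left_eq_zero := congrArg LieAlgebra.SemiDirectSum.left map_eq_zero
  exact root_X_pow_pow_ne_zero hn ((smul_eq_zero.1 left_eq_zero).resolve_left ht)

theorem not_isKRigid_of_adj_of_not_adj [Infinite K] [Finite V] (hk : 3 ≤ k) {u v w : V}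
    (huv : G.Adj u v) (hvw : v ≠ w) (hna : ¬ G.Adj v w) :
    ¬ IsKRigid K k (GraphLieAlgebra K k G) := by
  classical
  obtain ⟨n, rfl⟩ := Nat.exists_eq_add_of_le' hk
  intro hrigid
  have huw : u ≠ w := fun huw => hna (huw ▸ huv.symm)
  let x := of K (n + 3) G
  let z := (LieModule.toEnd K _ _ (x u))^[n + 2] (x v)
  have z_mem (i : ℕ) (hi : i ≤ n + 2) : z ∈ LieModule.lowerCentralSeries K _ _ i :=
    LieModule.antitone_lowerCentralSeries K _ _ hi
      (LieModule.iterate_toEnd_mem_lowerCentralSeries K _ _ _ _ _)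
  have z_mem_center : z ∈ LieAlgebra.center K (GraphLieAlgebra K (n + 3) G) :=
    mem_center_of_mem_lowerCentralSeries (lowerCentralSeries_eq_bot K _ G) (z_mem _ le_rfl)
  have coord_z (i : V) : coord K _ G i z = 0 := by
    rw [show z = ⁅x u, _⁆ from Function.iterate_succ_apply' _ _ _,
      LieAlgebra.lieCharacter_apply_lie]
  let φ := CentralCocycle.ofCharacters (coord K _ G v) (coord K _ G w) z z_mem_center
    (coord_z v) (coord_z w)
  have form_of_coord {a b : GraphLieAlgebra K (n + 3) G}
      (ha : ∀ i, coord K _ G i a = coord K _ G i (x v))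
      (hb : ∀ i, coord K _ G i b = coord K _ G i (x w)) : φ.form a b = z := by
    simp [φ, x, CentralCocycle.ofCharacters_form_apply, ha, hb, coord_of, hvw, hvw.symm]
  obtain ⟨t, ht, ⟨f⟩⟩ := hrigid.exists_lieEquiv_deformation (by lia) φ
  obtain ⟨a, b, ha, hb, hab⟩ := exists_lie_add_smul_form_eq_zero f (x := x v) (y := x w)
    (fun i _ _ => by simp [φ, CentralCocycle.ofCharacters_form_apply, coord_z])
    (by simpa [x, lie_of_of_eq_zero hna, form_of_coord] using
      (LieModule.lowerCentralSeries K _ _ 2).smul_mem t (z_mem 2 (by lia)))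
  rw [form_of_coord ha hb] at hab
  exact lie_add_smul_iterate_ne_zero huv (by simp [ha, x, coord_of, huv.ne])
    (by simp [hb, x, coord_of, huw]) ht (Nat.lt_succ_self _) hab

theorem not_isKRigid_bot [Infinite K] [Fintype V] (hV : 3 ≤ Fintype.card V) (hk : 2 ≤ k) :
    ¬ IsKRigid K k (GraphLieAlgebra K k (⊥ : SimpleGraph V)) := by
  classical
  intro hrigid
  have : NeZero k := ⟨by lia⟩
  have : IsLieAbelian (GraphLieAlgebra K k (⊥ : SimpleGraph V)) := isLieAbelian_bot
  obtain ⟨u, v, w, huv, huw, hvw⟩ := Fintype.two_lt_card_iff.1 hV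
  let x := of K k (⊥ : SimpleGraph V)
  let φ := CentralCocycle.ofCharacters (coord K k ⊥ v) (coord K k ⊥ w) (x u)
    (((LieAlgebra.isLieAbelian_iff_center_eq_top K _).1 this).ge (LieSubmodule.mem_top _))
    (by simp [x, coord_of, huv]) (by simp [x, coord_of, huw])
  obtain ⟨t, ht, ⟨f⟩⟩ := hrigid.exists_lieEquiv_deformation hk φ
  have : IsLieAbelian (φ.Deformation t) := (lie_abelian_iff_equiv_lie_abelian f).1 this
  have smul_form_eq_zero (x y : GraphLieAlgebra K k (⊥ : SimpleGraph V)) : t • φ.form x y = 0 := by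
    let e := CentralCocycle.Deformation.equiv φ t
    have equiv_lie := CentralCocycle.Deformation.equiv_lie (e.symm x) (e.symm y)
    rw [trivial_lie_zero, trivial_lie_zero] at equiv_lie
    simpa [e, -smul_eq_zero] using equiv_lie.symm
  have coord_smul := congrArg (coord K k ⊥ u) (smul_form_eq_zero (x v) (x w))
  simp [φ, x, CentralCocycle.ofCharacters_form_apply, coord_of, hvw, hvw.symm, ht] at coord_smul

end GraphLieAlgebra

theorem exists_adj_ne_not_adj {V : Type*} {G : SimpleGraph V} (hbot : G ≠ ⊥) (htop : G ≠ ⊤) :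
    ∃ u v w, G.Adj u v ∧ v ≠ w ∧ ¬ G.Adj v w := by
  by_contra! adj_of_adj
  obtain ⟨x, y, hxy⟩ := SimpleGraph.ne_bot_iff_exists_adj.1 hbot
  refine htop (eq_top_iff.2 fun v w hvw => ?_)
  by_cases hyv : y = v
  · exact adj_of_adj x v w (hyv ▸ hxy) hvw
  · exact adj_of_adj y v w (adj_of_adj x y v hxy hyv) hvw

theorem mainTheorem2_general {K : Type*} [Field K] [Infinite K] {V : Type*} [Fintype V]
    (G : SimpleGraph V) (hV : 3 ≤ Fintype.card V) (hG : G ≠ ⊤) (k : ℕ) (hk : 3 ≤ k) :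
    ¬ IsKRigid K k (GraphLieAlgebra K k G) := by
  by_cases hbot : G = ⊥
  · subst hbot
    exact GraphLieAlgebra.not_isKRigid_bot hV (by lia)
  · obtain ⟨u, v, w, huv, hvw, hna⟩ := exists_adj_ne_not_adj hbot hG
    exact GraphLieAlgebra.not_isKRigid_of_adj_of_not_adj hk huv hvw hna

theorem mainTheorem2 {K : Type*} [Field K] [IsAlgClosed K] [CharZero K]
    {V : Type*} [Fintype V] (G : SimpleGraph V) (hV : 3 ≤ Fintype.card V) (hG : G ≠ ⊤)
    (k : ℕ) (hk : 3 ≤ k) :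
    ¬ IsKRigid K k (GraphLieAlgebra K k G) :=
  mainTheorem2_general G hV hG k hk
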